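/- Let $\mathcal{A}$ be a finite alphabet with at least two letters, totally ordered by $<$, and order finite words over $\mathcal{A}$ lexicographically. A Lyndon word is a nonempty primitive finite word that is the smallest word in its conjugacy class. For an infinite word $\mathbf{x}\in\mathcal{A}^{\mathbb{N}}$ let $F(\mathbf{x})$ be the set of its finite factors, and let $\mathcal{L}_{\mathbf{x}}(n)$ be the number of distinct Lyndon words of length at most $n$ in $F(\mathbf{x})$. The word $\mathbf{x}$ is recurrent if each of its factors occurs in it at least twice, ultimately periodic if $\mathbf{x}=vuuu\cdots$ for some finite words $v,u$ with $u$ nonempty, and aperiodic if it is not ultimately periodic. The shift orbit closure of $\mathbf{x}$ is the set of all $\mathbf{y}\in\mathcal{A}^{\mathbb{N}}$ with $F(\mathbf{y})\subseteq F(\mathbf{x})$. For distinct letters $a,b\in\mathcal{A}$ (in either order) let $f_1=b$, $f_2=a$ and $f_n=f_{n-1}f_{n-2}$ for $n\ge 3$; the unique infinite word that has every $f_n$ with $n\ge 2$ as a prefix is called a Fibonacci infinite word. Let $\mathbf{x}\in\mathcal{A}^{\mathbb{N}}$ be recurrent and let $\mathbf{f}\in\mathcal{A}^{\mathbb{N}}$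 be any Fibonacci infinite word. Then $\mathbf{x}$ is aperiodic if and only if $\mathcal{L}_{\mathbf{x}}(n)\ge\mathcal{L}_{\mathbf{f}}(n)$ for all $n$. Moreover, $\mathcal{L}_{\mathbf{x}}(n)=\mathcal{L}_{\mathbf{f}}(n)$ for all $n$ if and only if $\mathbf{x}$ is in the shift orbit closure of some Fibonacci infinite word $\mathbf{g}\in\mathcal{A}^{\mathbb{N}}$ (over some pair of distinct letters of $\mathcal{A}$, not necessarily the pair of $\mathbf{f}$). -/

import Mathlib

/-! Finite words over `A` are `List A` (ordered lexicographically by the Mathlib order on lists),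
infinite words over `A` are `ℕ → A`, indexed from `0`. -/

namespace LyndonFib

variable {A : Type*}

/-- The finite word `w` occurs in the infinite word `x` at position `i`. -/
def OccursAt (x : ℕ → A) (w : List A) (i : ℕ) : Prop :=
  ∀ (j : ℕ) (hj : j < w.length), w[j] = x (i + j)

/-- `w` is a prefix of the infinite word `x`. -/
def IsPrefixOf (w : List A) (x : ℕ → A) : Prop := OccursAt x w 0

/-- The set `F(x)` of factors of the infinite word `x`. -/
def factors (x : ℕ → A) : Set (List A) := {w | ∃ i, OccursAt x w i}

/-- Each factor of `x` occurs at least twice in `x`. -/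
def Recurrent (x : ℕ → A) : Prop :=
  ∀ w ∈ factors x, ∃ i j, i ≠ j ∧ OccursAt x w i ∧ OccursAt x w j

/-- `x = uuu⋯` for some nonempty finite word `u`. -/
def PurelyPeriodic (x : ℕ → A) : Prop :=
  ∃ u : List A, u ≠ [] ∧ ∀ n, u[n % u.length]? = some (x n)

/-- `x` has a purely periodic tail. -/
def UltimatelyPeriodic (x : ℕ → A) : Prop :=
  ∃ m, PurelyPeriodic (fun n => x (m + n))

def Aperiodic (x : ℕ → A) : Prop := ¬ UltimatelyPeriodic x

/-- The shift orbit closure of `x`: all infinite words `y` with `F(y) ⊆ F(x)`. -/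
def shiftOrbitClosure (x : ℕ → A) : Set (ℕ → A) := {y | factors y ⊆ factors x}

/-- `w` is not of the form `u ^ k` with `k ≥ 2` and `u` nonempty. -/
def Primitive (w : List A) : Prop :=
  ¬ ∃ (u : List A) (k : ℕ), u ≠ [] ∧ 2 ≤ k ∧ w = (List.replicate k u).flatten

/-- Lyndon words: nonempty primitive words that are lexicographically smallest
among their conjugates. -/
def IsLyndon [LinearOrder A] (w : List A) : Prop :=
  w ≠ [] ∧ Primitive w ∧ ∀ u v : List A, w = u ++ v → w ≤ v ++ u

/-- `L_x(n)`: the number of Lyndon factors of `x` of length at most `n`. -/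
noncomputable def lyndonCount [LinearOrder A] (x : ℕ → A) (n : ℕ) : ℕ :=
  {w : List A | w ∈ factors x ∧ IsLyndon w ∧ w.length ≤ n}.ncard

/-- The finite Fibonacci words `f₁ = b`, `f₂ = a`, `fₙ = fₙ₋₁ fₙ₋₂`, with the index
lowered by one: `fibWord a b n` is `fₙ₊₁`. -/
def fibWord (a b : A) : ℕ → List A
  | 0 => [b]
  | 1 => [a]
  | n + 2 => fibWord a b (n + 1) ++ fibWord a b n

/-- `f` is a Fibonacci infinite word: for some distinct letters `a`, `b`, every finite Fibonacci
word `fₙ` with `n ≥ 2` (built from `f₁ = b`, `f₂ = a`) is a prefix of `f`. As `a`, `b` range over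
ordered pairs of letters, both Fibonacci infinite words over each pair are covered. -/
def IsFibonacciWord (f : ℕ → A) : Prop :=
  ∃ a b : A, a ≠ b ∧ ∀ n, 1 ≤ n → IsPrefixOf (fibWord a b n) f

theorem le_length_fibWord (a b : A) : ∀ n, n ≤ (fibWord a b n).length ∧ 1 ≤ (fibWord a b n).length
  | 0 => by simp [fibWord]
  | 1 => by simp [fibWord]
  | n + 2 => by
    have h1 := le_length_fibWord a b (n + 1)
    have h0 := le_length_fibWord a b n
    simp only [fibWord, List.length_append]
    omega

theorem fibWord_prefix (a b : A) {m n : ℕ} (hm : 1 ≤ m) (hmn : m ≤ n) :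
    fibWord a b m <+: fibWord a b n := by
  induction n, hmn using Nat.le_induction with
  | base => exact List.prefix_rfl
  | succ n hn ih =>
    obtain ⟨k, rfl⟩ : ∃ k, n = k + 1 := ⟨n - 1, by omega⟩
    exact ih.trans (List.prefix_append _ _)

/-- For all letters `a`, `b` there is exactly one infinite word having every `fₙ`, `n ≥ 2`,
as a prefix. -/
theorem existsUnique_fibonacciWord (a b : A) :
    ∃! f : ℕ → A, ∀ n, 1 ≤ n → IsPrefixOf (fibWord a b n) f := by
  have hl : ∀ k, k < (fibWord a b (k + 1)).length := fun k =>
    (le_length_fibWord a b (k + 1)).1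
  refine ⟨fun k => (fibWord a b (k + 1))[k]'(hl k), ?_, ?_⟩
  · intro n hn j hj
    simp only [Nat.zero_add]
    rcases le_total n (j + 1) with h | h
    · exact (fibWord_prefix a b hn h).getElem hj
    · exact ((fibWord_prefix a b (by omega) h).getElem (hl j)).symm
  · intro g hg
    funext k
    have := hg (k + 1) (by omega) k (hl k)
    simpa using this.symm

end LyndonFib

/-! Lower bound: at each position of an aperiodic word take the longest Lyndon factor of length at
most `N`, and chain these end to end. If no Lyndon `u < v` of length at most `N` had `uv` as a
factor longer than `N`, maximality would forbid every ascent in the chain, since `uv` is Lyndon. The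
chain would then be nonincreasing in a finite set, so eventually constant, and the word ultimately
periodic (`Aperiodic.exists_lyndon_append`). Taking `N` to be a Fibonacci number gives the count by
induction (`Aperiodic.le_lyndonCount_fib`). Conversely, Lyndon words are unbordered, so a recurrent
ultimately periodic word has Lyndon factors of bounded length only.

The Fibonacci word attains the bound: its Lyndon factors are the words `ℓ n = lyndonSeq a b n`, of
length `fib (n + 1)`, where `ℓ (n + 2)` is the product of the two previous words in increasing
order. Indeed, a Lyndon product of at least two blocks `ℓ n`, `ℓ (n + 1)` starts with the smaller
and ends with the larger block, and this allows desubstitution to the next level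
(`lyndon_eq_or_eq_lyndonSubst`).

If equality holds, the Lyndon words `squareWord` cannot occur: for `n ≥ 1` their lengths are not
Fibonacci numbers, and for `n = 0` the roles of the two letters are chosen accordingly. Their
absence refines a tiling of a tail by `ℓ n`, `ℓ (n + 1)` into one by `ℓ (n + 1)`, `ℓ (n + 2)`
(`tiled_lyndonSeq`). At a high level every factor lies in two consecutive blocks, and all such pairs
occur in the Fibonacci word. For the converse, the Fibonacci word is tiled in the same way, so every
long enough factor contains each given `ℓ n`. -/

namespace LyndonFib

variable {A : Type*}

/-! ### Lexicographic order and commuting words -/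

section Order

variable [LinearOrder A]

theorem append_cons_lt_append_cons (p z z' : List A) {c d : A} (h : c < d) :
    p ++ c :: z < p ++ d :: z' :=
  List.append_left_lt (List.Lex.rel h)

theorem lt_append_cons (u z : List A) (c : A) : u < u ++ c :: z := by
  induction u with
  | nil => exact List.Lex.nil
  | cons d u ih => exact List.Lex.cons ih

theorem le_append (u z : List A) : u ≤ u ++ z := by
  cases z with
  | nil => simp
  | cons c z => exact (lt_append_cons u z c).le

/-- `u` is smaller than `v` because of a position at which both have a letter. -/
def StrongLT (u v : List A) : Prop :=
  ∃ (p : List A) (c d : A) (z z' : List A), c < d ∧ u = p ++ c :: z ∧ v = p ++ d :: z'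

theorem StrongLT.append_lt_append {u v : List A} (h : StrongLT u v) (y y' : List A) :
    u ++ y < v ++ y' := by
  obtain ⟨p, c, d, z, z', hcd, rfl, rfl⟩ := h
  simpa using append_cons_lt_append_cons p (z ++ y) (z' ++ y') hcd

theorem strongLT_or_prefix_of_lt {u v : List A} (h : u < v) :
    StrongLT u v ∨ ∃ z, z ≠ [] ∧ v = u ++ z := by
  induction h with
  | @nil a l => exact Or.inr ⟨a :: l, by simp, rfl⟩
  | @rel a l b l' hab => exact Or.inl ⟨[], a, b, l, l', hab, rfl, rfl⟩
  | @cons a l l' h ih =>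
    rcases ih with ⟨p, c, d, z, z', hcd, rfl, rfl⟩ | ⟨z, hz, rfl⟩
    · exact Or.inl ⟨a :: p, c, d, z, z', hcd, rfl, rfl⟩
    · exact Or.inr ⟨z, hz, rfl⟩

end Order

theorem flatten_replicate_add (t : List A) (i j : ℕ) :
    (List.replicate (i + j) t).flatten =
      (List.replicate i t).flatten ++ (List.replicate j t).flatten := by
  rw [List.replicate_add, List.flatten_append]

/-- Commuting words are powers of a common word. -/
theorem exists_common_power_of_commute (n : ℕ) : ∀ u v : List A, u.length + v.length ≤ n →
    u ++ v = v ++ u → ∃ (t : List A) (i j : ℕ),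
      u = (List.replicate i t).flatten ∧ v = (List.replicate j t).flatten := by
  induction n using Nat.strong_induction_on with
  | _ n ih =>
    have key : ∀ u v : List A, u.length + v.length ≤ n → u.length ≤ v.length →
        u ++ v = v ++ u → ∃ (t : List A) (i j : ℕ),
          u = (List.replicate i t).flatten ∧ v = (List.replicate j t).flatten := by
      intro u v hn hle h
      rcases eq_or_ne u [] with rfl | hu
      · exact ⟨v, 0, 1, by simp, by simp⟩
      have hu' := List.length_pos_of_ne_nil hu
      obtain ⟨v', rfl⟩ : u <+: v :=
        List.prefix_of_prefix_length_le (List.prefix_append u v) (h ▸ List.prefix_append v u) hle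
      simp only [List.length_append] at hn
      obtain ⟨t, i, j, hi, hj⟩ := ih (u.length + v'.length) (by omega) u v' le_rfl
        (by simpa using h)
      exact ⟨t, i, i + j, hi, by rw [flatten_replicate_add, ← hi, ← hj]⟩
    intro u v hn h
    rcases le_total u.length v.length with hl | hl
    · exact key u v hn hl h
    · obtain ⟨t, i, j, hi, hj⟩ := key v u (by omega) hl h.symm
      exact ⟨t, j, i, hj, hi⟩

theorem Primitive.append_ne_append {u v : List A} (h : Primitive (u ++ v)) (hu : u ≠ [])
    (hv : v ≠ []) : u ++ v ≠ v ++ u := by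
  intro he
  obtain ⟨t, i, j, rfl, rfl⟩ := exists_common_power_of_commute _ u v le_rfl he
  refine h ⟨t, i + j, ?_, ?_, (flatten_replicate_add t i j).symm⟩
  · rintro rfl
    simp at hu
  · have : i ≠ 0 := by rintro rfl; simp at hu
    have : j ≠ 0 := by rintro rfl; simp at hv
    omega

/-! ### Lyndon words -/

section Lyndon

variable [LinearOrder A]

/-- If `v < uv` by a letter, then `vu < uv`. Otherwise `uv = vz` with `z`, `u` of equal length: `z <
u` or `u < z` makes a conjugate smaller, and `z = u` makes `u` and `v` commute, against primitivity.
-/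
theorem IsLyndon.lt_suffix {u v : List A} (h : IsLyndon (u ++ v)) (hu : u ≠ []) (hv : v ≠ []) :
    u ++ v < v := by
  obtain ⟨-, hp, hc⟩ := h
  have huv := hc u v rfl
  by_contra hlt
  rcases lt_or_eq_of_le (not_lt.1 hlt) with h1 | h1
  · rcases strongLT_or_prefix_of_lt h1 with h2 | ⟨z, hz, h2⟩
    · have := h2.append_lt_append u []
      rw [List.append_nil] at this
      exact absurd huv (not_le.2 this)
    · have hzv := hc v z h2
      have hlen : z.length = u.length := by
        have := congrArg List.length h2
        simp only [List.length_append] at this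
        omega
      rcases lt_trichotomy z u with h3 | h3 | h3
      · rcases strongLT_or_prefix_of_lt h3 with h4 | ⟨y, hy, rfl⟩
        · exact absurd hzv (not_le.2 (h4.append_lt_append v v))
        · have := List.length_pos_of_ne_nil hy
          simp only [List.length_append] at hlen
          omega
      · subst h3
        exact hp.append_ne_append hu hv h2
      · have : v ++ u < v ++ z := List.append_left_lt h3
        rw [← h2] at this
        exact absurd huv (not_le.2 this)
  · have := congrArg List.length h1
    simp only [List.length_append] at this
    have := List.length_pos_of_ne_nil hu
    omega

theorem isLyndon_of_lt_suffix {w : List A} (hw : w ≠ [])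
    (h : ∀ u v, w = u ++ v → u ≠ [] → v ≠ [] → w < v) : IsLyndon w := by
  refine ⟨hw, ?_, ?_⟩
  · rintro ⟨u, k, hu, hk, rfl⟩
    obtain ⟨k, rfl⟩ : ∃ m, k = m + 2 := ⟨k - 2, by omega⟩
    have e1 : (List.replicate (k + 2) u).flatten = u ++ (List.replicate (k + 1) u).flatten := by
      simp [List.replicate_succ]
    have e2 : (List.replicate (k + 2) u).flatten = (List.replicate (k + 1) u).flatten ++ u := by
      rw [flatten_replicate_add u (k + 1) 1]
      simp
    have := h _ _ e2 (by simp [List.replicate_succ, hu]) hu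
    rw [e1] at this
    exact absurd (le_append u _) (not_le.2 this)
  · rintro u v rfl
    rcases eq_or_ne u [] with rfl | hu
    · simp
    rcases eq_or_ne v [] with rfl | hv
    · simp
    exact (h u v rfl hu hv).le.trans (le_append v u)

theorem isLyndon_singleton (c : A) : IsLyndon [c] := by
  refine isLyndon_of_lt_suffix (by simp) fun u v h hu hv => ?_
  have := congrArg List.length h
  simp only [List.length_append, List.length_singleton] at this
  have := List.length_pos_of_ne_nil hu
  have := List.length_pos_of_ne_nil hv
  omega

theorem IsLyndon.append_lt_right {u v : List A} (hu : u ≠ []) (hv : IsLyndon v) (h : u < v) :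
    u ++ v < v := by
  rcases strongLT_or_prefix_of_lt h with h1 | ⟨z, hz, rfl⟩
  · simpa using h1.append_lt_append v []
  · exact List.append_left_lt (hv.lt_suffix hu hz)

theorem IsLyndon.append {u v : List A} (hu : IsLyndon u) (hv : IsLyndon v) (h : u < v) :
    IsLyndon (u ++ v) := by
  have huv := IsLyndon.append_lt_right hu.1 hv h
  refine isLyndon_of_lt_suffix (by simp [hu.1]) fun p q he hp hq => ?_
  rcases List.append_eq_append_iff.1 he with ⟨y, rfl, rfl⟩ | ⟨y, rfl, rfl⟩
  · rcases eq_or_ne y [] with rfl | hy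
    · exact huv
    · exact huv.trans (hv.lt_suffix hy hq)
  · rcases eq_or_ne y [] with rfl | hy
    · simpa using huv
    · rcases strongLT_or_prefix_of_lt (hu.lt_suffix hp hy) with h1 | ⟨z, hz, h1⟩
      · exact h1.append_lt_append v v
      · have := congrArg List.length h1
        simp only [List.length_append] at this
        have := List.length_pos_of_ne_nil hp
        omega

theorem IsLyndon.append_append_right {u v : List A} (hu : IsLyndon u) (hv : IsLyndon v)
    (h : u < v) : IsLyndon (u ++ v ++ v) :=
  (hu.append hv h).append hv (IsLyndon.append_lt_right hu.1 hv h)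

theorem IsLyndon.append_append_left {u v : List A} (hu : IsLyndon u) (hv : IsLyndon v)
    (h : u < v) : IsLyndon (u ++ (u ++ v)) := by
  refine hu.append (hu.append hv h) ?_
  obtain ⟨c, z, rfl⟩ := List.exists_cons_of_ne_nil hv.1
  exact lt_append_cons u z c

/-- A Lyndon word is unbordered. -/
theorem IsLyndon.not_prefix_of_suffix {u v z : List A} (h : IsLyndon (u ++ v)) (hu : u ≠ [])
    (hv : v ≠ []) : u ++ v ≠ v ++ z := by
  intro he
  have := h.lt_suffix hu hv
  rw [he] at this
  exact absurd (le_append v z) (not_le.2 this)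

end Lyndon

/-! ### Occurrences of factors -/

section Occurrences

theorem occursAt_append {x : ℕ → A} {u v : List A} {i : ℕ} :
    OccursAt x (u ++ v) i ↔ OccursAt x u i ∧ OccursAt x v (i + u.length) := by
  constructor
  · intro h
    refine ⟨fun j hj => ?_, fun j hj => ?_⟩
    · rw [← h j (by simp; omega), List.getElem_append_left hj]
    · rw [Nat.add_assoc, ← h (u.length + j) (by simp; omega),
        List.getElem_append_right (by omega)]
      simp
  · rintro ⟨h1, h2⟩ j hj
    rcases lt_or_ge j u.length with h | h
    · rw [List.getElem_append_left h, h1 j h]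
    · rw [List.getElem_append_right h, h2 (j - u.length) (by simp at hj; omega)]
      congr 1
      omega

theorem OccursAt.eq_of_length_eq {x : ℕ → A} {u v : List A} {i : ℕ} (hu : OccursAt x u i)
    (hv : OccursAt x v i) (h : u.length = v.length) : u = v :=
  List.ext_getElem h fun j h1 h2 => by rw [hu j h1, hv j h2]

theorem occursAt_ofFn (x : ℕ → A) (i n : ℕ) :
    OccursAt x (List.ofFn fun j : Fin n => x (i + j)) i := fun j hj => by simp

theorem mem_factors_of_isInfix {x : ℕ → A} {u v : List A} (h : u <:+: v) (hv : v ∈ factors x) :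
    u ∈ factors x := by
  obtain ⟨p, q, rfl⟩ := h
  obtain ⟨i, hi⟩ := hv
  exact ⟨_, (occursAt_append.1 (occursAt_append.1 hi).1).2⟩

/-- A factor occurring at `i` that covers an occurrence of another word contains that word. -/
theorem OccursAt.isInfix {x : ℕ → A} {u v : List A} {i k : ℕ} (hv : OccursAt x v i)
    (hu : OccursAt x u k) (hik : i ≤ k) (hk : k + u.length ≤ i + v.length) : u <:+: v := by
  refine ⟨v.take (k - i), v.drop (k - i + u.length), ?_⟩
  have e : v = v.take (k - i) ++ ((v.drop (k - i)).take u.length ++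
      (v.drop (k - i)).drop u.length) := by
    rw [List.take_append_drop, List.take_append_drop]
  have h2 := hv
  rw [e, occursAt_append, occursAt_append] at h2
  have h3 := h2.2.1
  have hl : (v.take (k - i)).length = k - i := by
    rw [List.length_take]
    omega
  rw [hl, Nat.add_sub_cancel' hik] at h3
  have h4 := h3.eq_of_length_eq hu (by simp; omega)
  conv_rhs => rw [e, h4, List.drop_drop]
  simp

/-- The prefix ending with an occurrence of `w` occurs again at a positive position, which moves
that occurrence strictly to the right. -/
theorem Recurrent.exists_occursAt_ge {x : ℕ → A} (hx : Recurrent x) {w : List A}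
    (hw : w ∈ factors x) (m : ℕ) : ∃ i, m ≤ i ∧ OccursAt x w i := by
  induction m with
  | zero =>
    obtain ⟨i, hi⟩ := hw
    exact ⟨i, Nat.zero_le _, hi⟩
  | succ m ih =>
    obtain ⟨i, hmi, hi⟩ := ih
    have hp := occursAt_ofFn x 0 i
    have hpl : (List.ofFn fun j : Fin i => x (0 + j)).length = i := by simp
    have hpw : OccursAt x ((List.ofFn fun j : Fin i => x (0 + j)) ++ w) 0 :=
      occursAt_append.2 ⟨hp, by rwa [hpl, Nat.zero_add]⟩
    obtain ⟨k, l, hkl, hk, hl⟩ := hx _ ⟨0, hpw⟩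
    have key : ∀ k, 0 < k → OccursAt x ((List.ofFn fun j : Fin i => x (0 + j)) ++ w) k →
        ∃ i, m + 1 ≤ i ∧ OccursAt x w i := fun k h0 hk =>
      ⟨k + i, by omega, hpl ▸ (occursAt_append.1 hk).2⟩
    rcases Nat.eq_zero_or_pos k with rfl | h0
    · exact key l (by omega) hl
    · exact key k h0 hk

theorem ultimatelyPeriodic_of_occursAt {x : ℕ → A} {u : List A} (hu : u ≠ []) (m : ℕ)
    (h : ∀ k, OccursAt x u (m + k * u.length)) : UltimatelyPeriodic x := by
  refine ⟨m, u, hu, fun n => ?_⟩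
  have hlt : n % u.length < u.length := Nat.mod_lt _ (List.length_pos_of_ne_nil hu)
  rw [List.getElem?_eq_getElem hlt, h (n / u.length) _ hlt]
  have := Nat.div_add_mod' n u.length
  congr 2
  omega

end Occurrences

/-! ### Lower bound for aperiodic words -/

section LowerBound

variable [LinearOrder A] [Finite A]

theorem finite_lyndon_length_le (x : ℕ → A) (n : ℕ) :
    {w : List A | w ∈ factors x ∧ IsLyndon w ∧ w.length ≤ n}.Finite :=
  (List.finite_length_le A n).subset fun _ h => h.2.2

theorem lyndonCount_mono (x : ℕ → A) {m n : ℕ} (h : m ≤ n) :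
    lyndonCount x m ≤ lyndonCount x n :=
  Set.ncard_le_ncard (fun _ hw => ⟨hw.1, hw.2.1, hw.2.2.trans h⟩) (finite_lyndon_length_le x n)

/-- In an aperiodic word the concatenations of short Lyndon factors give longer ones. -/
theorem Aperiodic.exists_lyndon_append {x : ℕ → A} (hx : Aperiodic x) {N : ℕ} (hN : 1 ≤ N) :
    ∃ u v : List A, IsLyndon u ∧ IsLyndon v ∧ u < v ∧ u.length ≤ N ∧ v.length ≤ N ∧
      u ++ v ∈ factors x ∧ N < (u ++ v).length := by
  by_contra hcon
  have hex : ∀ i, ∃ w : List A, (OccursAt x w i ∧ IsLyndon w ∧ w.length ≤ N) ∧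
      ∀ w', (OccursAt x w' i ∧ IsLyndon w' ∧ w'.length ≤ N) → w'.length ≤ w.length := by
    intro i
    obtain ⟨w, hw, hmax⟩ := Set.exists_max_image
      {w : List A | OccursAt x w i ∧ IsLyndon w ∧ w.length ≤ N} List.length
      ((finite_lyndon_length_le x N).subset fun w h => ⟨⟨i, h.1⟩, h.2⟩)
      ⟨[x i], by intro j hj; simp at hj; simp [hj], isLyndon_singleton _, by simpa⟩
    exact ⟨w, hw, hmax⟩
  choose t ht hmax using hex
  -- Cut points of the chain: start at `0` and jump over the longest short Lyndon block each time.
  let pos : ℕ → ℕ := fun n => Nat.rec 0 (fun _ i => i + (t i).length) n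
  have hpos : ∀ n, pos (n + 1) = pos n + (t (pos n)).length := fun n => rfl
  have hanti : Antitone fun n => t (pos n) := by
    refine antitone_nat_of_succ_le fun n => ?_
    by_contra hlt
    rw [not_le] at hlt
    obtain ⟨h1, h2, h3⟩ := ht (pos n)
    obtain ⟨h1', h2', h3'⟩ := ht (pos (n + 1))
    have hocc : OccursAt x (t (pos n) ++ t (pos (n + 1))) (pos n) :=
      occursAt_append.2 ⟨h1, h1'⟩
    refine hcon ⟨_, _, h2, h2', hlt, h3, h3', ⟨_, hocc⟩, ?_⟩
    by_contra hle
    -- A short product of an ascent would be a longer candidate at the same position.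
    have hle' := hmax _ _ ⟨hocc, h2.append h2' hlt, not_lt.1 hle⟩
    have := List.length_pos_of_ne_nil h2'.1
    rw [List.length_append] at hle'
    omega
  have hfin : (Set.range fun n => t (pos n)).Finite :=
    (finite_lyndon_length_le x N).subset (by
      rintro _ ⟨n, rfl⟩
      exact ⟨⟨_, (ht _).1⟩, (ht _).2⟩)
  obtain ⟨_, ⟨j, rfl⟩, hmin⟩ := Set.exists_min_image _ id hfin ⟨_, 0, rfl⟩
  have hconst : ∀ k, t (pos (j + k)) = t (pos j) := fun k =>
    le_antisymm (hanti (Nat.le_add_right j k)) (hmin _ ⟨j + k, rfl⟩)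
  have hpk : ∀ k, pos (j + k) = pos j + k * (t (pos j)).length := by
    intro k
    induction k with
    | zero => simp
    | succ k ih => rw [← Nat.add_assoc, hpos, hconst, ih]; ring
  exact hx (ultimatelyPeriodic_of_occursAt (ht (pos j)).2.1.1 (pos j) fun k => by
    rw [← hpk, ← hconst k]
    exact (ht _).1)

theorem Aperiodic.two_le_lyndonCount {x : ℕ → A} (hx : Aperiodic x) : 2 ≤ lyndonCount x 1 := by
  obtain ⟨u, v, hu, hv, hlt, hu1, hv1, huv, -⟩ := hx.exists_lyndon_append le_rfl
  rw [lyndonCount, ← Set.ncard_pair hlt.ne]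
  refine Set.ncard_le_ncard ?_ (finite_lyndon_length_le x 1)
  rintro w (rfl | rfl)
  · exact ⟨mem_factors_of_isInfix (List.prefix_append _ _).isInfix huv, hu, hu1⟩
  · exact ⟨mem_factors_of_isInfix (List.suffix_append _ _).isInfix huv, hv, hv1⟩

theorem Aperiodic.le_lyndonCount_fib {x : ℕ → A} (hx : Aperiodic x) (k : ℕ) :
    k + 1 ≤ lyndonCount x (Nat.fib (k + 1)) ∧ k + 2 ≤ lyndonCount x (Nat.fib (k + 2)) := by
  induction k with
  | zero =>
    have := hx.two_le_lyndonCount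
    simp
    omega
  | succ k ih =>
    refine ⟨ih.2, ?_⟩
    obtain ⟨h1, h2⟩ := ih
    have hfib : Nat.fib (k + 3) = Nat.fib (k + 1) + Nat.fib (k + 2) := Nat.fib_add_two
    by_contra hcon
    rw [show k + 1 + 2 = k + 3 from rfl] at hcon
    let S : ℕ → Set (List A) := fun n => {w | w ∈ factors x ∧ IsLyndon w ∧ w.length ≤ n}
    have hS : ∀ n, (S n).Finite := finite_lyndon_length_le x
    have hc : ∀ n, (S n).ncard = lyndonCount x n := fun n => rfl
    have hsub : ∀ {m n}, m ≤ n → S m ⊆ S n := fun h w hw => ⟨hw.1, hw.2.1, hw.2.2.trans h⟩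
    have hm : Nat.fib (k + 1) ≤ Nat.fib (k + 2) := Nat.fib_mono (by omega)
    -- If the bound fails, the counts for `fib (k + 2)` and `fib (k + 3)` are both `k + 2`, so no
    -- new word appears between them and at most one appears between `fib (k + 1)` and `fib (k +
    -- 2)`.
    have heq : S (Nat.fib (k + 2)) = S (Nat.fib (k + 3)) :=
      Set.eq_of_subset_of_ncard_le (hsub (by omega)) (by rw [hc, hc]; omega) (hS _)
    have hfew : (S (Nat.fib (k + 2)) \ S (Nat.fib (k + 1))).ncard ≤ 1 := by
      rw [Set.ncard_sdiff (hsub hm) (hS _), heq, hc, hc]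
      omega
    obtain ⟨u, v, hu, hv, hlt, hu1, hv1, huv, hlen⟩ :=
      hx.exists_lyndon_append (N := Nat.fib (k + 3)) (Nat.fib_pos.2 (by omega))
    have hu2 : u ∈ S (Nat.fib (k + 2)) :=
      heq ▸ ⟨mem_factors_of_isInfix (List.prefix_append _ _).isInfix huv, hu, hu1⟩
    have hv2 : v ∈ S (Nat.fib (k + 2)) :=
      heq ▸ ⟨mem_factors_of_isInfix (List.suffix_append _ _).isInfix huv, hv, hv1⟩
    have := hu2.2.2
    have := hv2.2.2
    rw [List.length_append] at hlen
    -- Neither length exceeds `fib (k + 2)`, while their sum exceeds `fib (k + 1) + fib (k + 2)`; so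
    -- both exceed `fib (k + 1)`, and only one such word exists.
    refine hlt.ne ((Set.ncard_le_one ((hS _).sdiff)).1 hfew u ⟨hu2, fun h => ?_⟩ v
      ⟨hv2, fun h => ?_⟩)
    · have := h.2.2
      omega
    · have := h.2.2
      omega

end LowerBound

/-! ### Recurrent ultimately periodic words -/

section Periodic

variable [LinearOrder A]

/-- The Lyndon factors of a recurrent ultimately periodic word have bounded length. -/
theorem Recurrent.exists_length_le_of_ultimatelyPeriodic {x : ℕ → A} (hx : Recurrent x)
    (hp : UltimatelyPeriodic x) : ∃ p, ∀ w ∈ factors x, IsLyndon w → w.length ≤ p := by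
  obtain ⟨m, u, hu, h⟩ := hp
  have hupos := List.length_pos_of_ne_nil hu
  refine ⟨u.length, fun w hw hwl => ?_⟩
  by_contra hlen
  rw [not_le] at hlen
  obtain ⟨i, hmi, hi⟩ := hx.exists_occursAt_ge hw m
  have hper : ∀ n, m ≤ n → x (n + u.length) = x n := by
    intro n hn
    have h1 := h (n - m)
    have h2 := h (n - m + u.length)
    rw [Nat.add_mod_right, h1, Option.some_inj] at h2
    beta_reduce at h2
    rw [show m + (n - m + u.length) = n + u.length by omega,
      show m + (n - m) = n by omega] at h2
    exact h2.symm
  have e := List.take_append_drop u.length w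
  have e' := List.take_append_drop (w.length - u.length) w
  have hocc := hi
  rw [← e, occursAt_append] at hocc
  have hocc' := hi
  rw [← e', occursAt_append] at hocc'
  have hl : (w.take u.length).length = u.length := by simp; omega
  -- A word longer than its period has a border.
  have hdrop : w.drop u.length = w.take (w.length - u.length) := by
    refine List.ext_getElem (by simp) fun j h1 h2 => ?_
    rw [hocc.2 j h1, hocc'.1 j h2, hl, Nat.add_right_comm]
    exact hper _ (by omega)
  refine IsLyndon.not_prefix_of_suffix (z := w.drop (w.length - u.length)) (e.symm ▸ hwl)
    (fun h => ?_) (fun h => ?_) ?_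
  · rw [h] at hl
    simp at hl
    omega
  · simp at h
    omega
  · rw [e, hdrop, e']

end Periodic

/-! ### Factors of the Fibonacci words and desubstitution -/

section FibonacciLanguage

/-- The factors of the Fibonacci words over `Bool`. -/
def FibLang (c : List Bool) : Prop := ∃ n, c <:+: fibWord true false n

theorem FibLang.of_isInfix {c d : List Bool} (h : c <:+: d) (hd : FibLang d) : FibLang c :=
  hd.imp fun _ hn => h.trans hn

/-- The Fibonacci morphism `1 ↦ 10`, `0 ↦ 1`. -/
def fibMorph (c : List Bool) : List Bool :=
  c.flatMap fun e => if e then [true, false] else [true]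

/-- The conjugate `1 ↦ 01`, `0 ↦ 1` of the Fibonacci morphism. -/
def fibMorphConj (c : List Bool) : List Bool :=
  c.flatMap fun e => if e then [false, true] else [true]

theorem fibMorph_append (c d : List Bool) : fibMorph (c ++ d) = fibMorph c ++ fibMorph d :=
  List.flatMap_append

theorem fibMorph_cons (e : Bool) (c : List Bool) :
    fibMorph (e :: c) = (if e then [true, false] else [true]) ++ fibMorph c := rfl

theorem fibMorphConj_cons (e : Bool) (c : List Bool) :
    fibMorphConj (e :: c) = (if e then [false, true] else [true]) ++ fibMorphConj c := rfl

theorem fibMorph_fibWord (n : ℕ) :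
    fibMorph (fibWord true false n) = fibWord true false (n + 1) := by
  induction n using Nat.twoStepInduction with
  | zero => rfl
  | one => rfl
  | more n h0 h1 => rw [fibWord, fibMorph_append, h0, h1, ← fibWord]

theorem true_cons_fibMorphConj (c : List Bool) :
    true :: fibMorphConj c = fibMorph c ++ [true] := by
  induction c with
  | nil => rfl
  | cons e c ih => cases e <;> simp [fibMorph_cons, fibMorphConj_cons, ih]

/-- The shift is by two because `[b]` is not a factor of `[a]`. -/
theorem fibWord_infix_add_two (a b : A) (n : ℕ) : fibWord a b n <:+: fibWord a b (n + 2) :=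
  (List.suffix_append _ _).isInfix

theorem FibLang.fibMorph {c : List Bool} (h : FibLang c) : FibLang (fibMorph c) := by
  obtain ⟨n, p, q, hn⟩ := h
  refine ⟨n + 1, LyndonFib.fibMorph p, LyndonFib.fibMorph q, ?_⟩
  rw [← fibMorph_fibWord, ← hn, fibMorph_append, fibMorph_append]

theorem FibLang.exists_append {c : List Bool} (h : FibLang c) : ∃ e, FibLang (c ++ [e]) := by
  obtain ⟨n, hn⟩ := h
  obtain ⟨p, q, hn⟩ := hn.trans (fibWord_infix_add_two true false n)
  have hpos := (le_length_fibWord true false (n + 1)).2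
  obtain ⟨e, z, he⟩ := List.exists_cons_of_ne_nil (List.ne_nil_of_length_pos hpos)
  cases q with
  | cons e' q => exact ⟨e', n + 2, p, q, by simp [← hn]⟩
  | nil =>
    refine ⟨e, n + 3, p, z, ?_⟩
    rw [fibWord, ← hn, he]
    simp

/-- The two morphisms are conjugate by the letter `true`. Since the image of any letter starts with
`true`, extending `c` by one letter on the right supplies the missing `true`. -/
theorem FibLang.fibMorphConj {c : List Bool} (h : FibLang c) : FibLang (fibMorphConj c) := by
  obtain ⟨e, he⟩ := h.exists_append
  refine FibLang.of_isInfix ?_ he.fibMorph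
  refine (List.suffix_cons true _).isInfix.trans ?_
  rw [true_cons_fibMorphConj, fibMorph_append]
  cases e
  · exact List.infix_rfl
  · exact ⟨[], [false], by simp [LyndonFib.fibMorph]⟩

/-- The letter `false` occurs only as the end of the image of `true`, so the prefix ends at a
boundary between images. -/
theorem exists_eq_fibMorph_of_isPrefix {c d : List Bool} (h : c ++ [false] <+: fibMorph d) :
    ∃ c', c' <+: d ∧ c ++ [false] = fibMorph c' := by
  induction d generalizing c with
  | nil => simp [fibMorph] at h
  | cons e d ih =>
    rw [fibMorph_cons] at h
    cases e with
    | false =>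
      cases c with
      | nil => simp [List.cons_prefix_cons] at h
      | cons x c =>
        simp [List.cons_prefix_cons] at h
        obtain ⟨c', hc', he⟩ := ih h.2
        exact ⟨false :: c', by simpa [List.cons_prefix_cons], by
          simp [fibMorph_cons, ← he, h.1]⟩
    | true =>
      cases c with
      | nil => simp [List.cons_prefix_cons] at h
      | cons x c =>
        cases c with
        | nil =>
          simp [List.cons_prefix_cons] at h
          exact ⟨[true], by simp [List.cons_prefix_cons], by simp [fibMorph, h]⟩
        | cons y c =>
          simp [List.cons_prefix_cons] at h
          obtain ⟨c', hc', he⟩ := ih h.2.2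
          exact ⟨true :: c', by simpa [List.cons_prefix_cons], by
            simp [fibMorph_cons, ← he, h.1, h.2.1]⟩

theorem exists_eq_fibMorph_of_isInfix {c d : List Bool}
    (h : true :: (c ++ [false]) <:+: fibMorph d) :
    ∃ c', c' <:+: d ∧ true :: (c ++ [false]) = fibMorph c' := by
  induction d with
  | nil => simp [fibMorph] at h
  | cons e d ih =>
    by_cases hp : true :: (c ++ [false]) <+: fibMorph (e :: d)
    · obtain ⟨c', hc', he⟩ := exists_eq_fibMorph_of_isPrefix (c := true :: c) hp
      exact ⟨c', hc'.isInfix, he⟩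
    · have : true :: (c ++ [false]) <:+: fibMorph d := by
        rw [fibMorph_cons] at h hp
        cases e <;> simp [List.infix_cons_iff, List.cons_prefix_cons] at h hp <;> tauto
      obtain ⟨c', hc', he⟩ := ih this
      exact ⟨c', List.infix_cons hc', he⟩

/-- The letter `true` always ends an image, so the prefix ends at a boundary. -/
theorem exists_eq_fibMorphConj_of_isPrefix {c d : List Bool} (h : c ++ [true] <+: fibMorphConj d) :
    ∃ c', c' <+: d ∧ c ++ [true] = fibMorphConj c' := by
  induction d generalizing c with
  | nil => simp [fibMorphConj] at h
  | cons e d ih =>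
    rw [fibMorphConj_cons] at h
    cases e with
    | false =>
      cases c with
      | nil => exact ⟨[false], by simp [List.cons_prefix_cons], rfl⟩
      | cons x c =>
        simp [List.cons_prefix_cons] at h
        obtain ⟨c', hc', he⟩ := ih h.2
        exact ⟨false :: c', by simpa [List.cons_prefix_cons], by
          simp [fibMorphConj_cons, ← he, h.1]⟩
    | true =>
      cases c with
      | nil => simp [List.cons_prefix_cons] at h
      | cons x c =>
        cases c with
        | nil =>
          simp [List.cons_prefix_cons] at h
          exact ⟨[true], by simp [List.cons_prefix_cons], by simp [fibMorphConj, h]⟩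
        | cons y c =>
          simp [List.cons_prefix_cons] at h
          obtain ⟨c', hc', he⟩ := ih h.2.2
          exact ⟨true :: c', by simpa [List.cons_prefix_cons], by
            simp [fibMorphConj_cons, ← he, h.1, h.2.1]⟩

theorem exists_eq_fibMorphConj_of_isInfix {c d : List Bool}
    (h : false :: (c ++ [true]) <:+: fibMorphConj d) :
    ∃ c', c' <:+: d ∧ false :: (c ++ [true]) = fibMorphConj c' := by
  induction d with
  | nil => simp [fibMorphConj] at h
  | cons e d ih =>
    by_cases hp : false :: (c ++ [true]) <+: fibMorphConj (e :: d)
    · obtain ⟨c', hc', he⟩ := exists_eq_fibMorphConj_of_isPrefix (c := false :: c) hp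
      exact ⟨c', hc'.isInfix, he⟩
    · have : false :: (c ++ [true]) <:+: fibMorphConj d := by
        rw [fibMorphConj_cons] at h hp
        cases e <;> simp [List.infix_cons_iff, List.cons_prefix_cons] at h hp <;> tauto
      obtain ⟨c', hc', he⟩ := ih this
      exact ⟨c', List.infix_cons hc', he⟩

theorem FibLang.exists_infix_fibMorph {c : List Bool} (h : FibLang c) :
    ∃ d, FibLang d ∧ c <:+: LyndonFib.fibMorph d := by
  obtain ⟨n, hn⟩ := h
  refine ⟨fibWord true false (n + 1), ⟨n + 1, List.infix_rfl⟩, ?_⟩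
  rw [fibMorph_fibWord]
  exact hn.trans (fibWord_infix_add_two true false n)

theorem FibLang.exists_eq_fibMorph {c : List Bool} (h : FibLang (true :: (c ++ [false]))) :
    ∃ c', FibLang c' ∧ true :: (c ++ [false]) = LyndonFib.fibMorph c' := by
  obtain ⟨d, hd, hi⟩ := h.exists_infix_fibMorph
  obtain ⟨c', hc', he⟩ := exists_eq_fibMorph_of_isInfix hi
  exact ⟨c', hd.of_isInfix hc', he⟩

theorem FibLang.exists_eq_fibMorphConj {c : List Bool} (h : FibLang (false :: (c ++ [true]))) :
    ∃ c', FibLang c' ∧ false :: (c ++ [true]) = LyndonFib.fibMorphConj c' := by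
  obtain ⟨d, hd, hi⟩ := h.exists_infix_fibMorph
  have hi' : false :: (c ++ [true]) <:+: LyndonFib.fibMorphConj d := by
    have : false :: (c ++ [true]) <:+: true :: LyndonFib.fibMorphConj d := by
      rw [true_cons_fibMorphConj]
      exact hi.trans (List.prefix_append _ _).isInfix
    simpa [List.infix_cons_iff, List.cons_prefix_cons] using this
  obtain ⟨c', hc', he⟩ := exists_eq_fibMorphConj_of_isInfix hi'
  exact ⟨c', hd.of_isInfix hc', he⟩

/-- This includes `[false, false]`, which is not itself a Fibonacci factor; hence pairs of blocks
are handled one level down. -/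
theorem fibLang_fibMorph_pair (e e' : Bool) : FibLang (fibMorph [e, e']) :=
  ⟨7, by cases e <;> cases e' <;> decide⟩

theorem fibLang_fibMorphConj_pair (e e' : Bool) : FibLang (fibMorphConj [e, e']) :=
  ⟨7, by cases e <;> cases e' <;> decide⟩

end FibonacciLanguage

/-! ### The Lyndon words of the Fibonacci word -/

section LyndonSequence

variable [LinearOrder A]

/-- The Lyndon factors of the Fibonacci words over `a` and `b`, by increasing length. -/
def lyndonSeq (a b : A) : ℕ → List A
  | 0 => [b]
  | 1 => [a]
  | n + 2 =>
    if lyndonSeq a b n < lyndonSeq a b (n + 1) then lyndonSeq a b n ++ lyndonSeq a b (n + 1)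
    else lyndonSeq a b (n + 1) ++ lyndonSeq a b n

theorem lyndonSeq_add_two_of_lt {a b : A} {n : ℕ} (h : lyndonSeq a b n < lyndonSeq a b (n + 1)) :
    lyndonSeq a b (n + 2) = lyndonSeq a b n ++ lyndonSeq a b (n + 1) := by
  rw [lyndonSeq, if_pos h]

theorem lyndonSeq_add_two_of_gt {a b : A} {n : ℕ} (h : lyndonSeq a b (n + 1) < lyndonSeq a b n) :
    lyndonSeq a b (n + 2) = lyndonSeq a b (n + 1) ++ lyndonSeq a b n := by
  rw [lyndonSeq, if_neg (not_lt.2 h.le)]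

theorem length_lyndonSeq (a b : A) (n : ℕ) : (lyndonSeq a b n).length = Nat.fib (n + 1) := by
  induction n using Nat.twoStepInduction with
  | zero => rfl
  | one => rfl
  | more n h0 h1 =>
    rw [lyndonSeq, Nat.fib_add_two, ← h0, ← h1]
    split_ifs
    · simp
    · simp [Nat.add_comm]

theorem lyndonSeq_injective {a b : A} (hab : a ≠ b) : Function.Injective (lyndonSeq a b) := by
  have key : ∀ m n, m < n → lyndonSeq a b m ≠ lyndonSeq a b n := by
    intro m n hmn h
    have hl := congrArg List.length h
    rw [length_lyndonSeq, length_lyndonSeq] at hl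
    rcases Nat.lt_or_ge 1 n with hn | hn
    · have h1 : Nat.fib (m + 1) ≤ Nat.fib n := Nat.fib_mono (by omega)
      have h2 : Nat.fib n < Nat.fib (n + 1) := Nat.fib_lt_fib_succ hn
      omega
    · obtain rfl : n = 1 := by omega
      obtain rfl : m = 0 := by omega
      simp [lyndonSeq] at h
      exact hab h.symm
  intro m n h
  rcases lt_trichotomy m n with hmn | hmn | hmn
  · exact absurd h (key m n hmn)
  · exact hmn
  · exact absurd h.symm (key n m hmn)

theorem lyndonSeq_lt_or_gt {a b : A} (hab : a ≠ b) (n : ℕ) :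
    lyndonSeq a b n < lyndonSeq a b (n + 1) ∨ lyndonSeq a b (n + 1) < lyndonSeq a b n :=
  lt_or_gt_of_ne fun h => by simpa using lyndonSeq_injective hab h

theorem isLyndon_lyndonSeq {a b : A} (hab : a ≠ b) (n : ℕ) : IsLyndon (lyndonSeq a b n) := by
  induction n using Nat.twoStepInduction with
  | zero => exact isLyndon_singleton b
  | one => exact isLyndon_singleton a
  | more n h0 h1 =>
    rcases lyndonSeq_lt_or_gt hab n with h | h
    · rw [lyndonSeq_add_two_of_lt h]
      exact h0.append h1 h
    · rw [lyndonSeq_add_two_of_gt h]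
      exact h1.append h0 h

/-- The word obtained from `c` by the substitution of two consecutive terms of `lyndonSeq`. -/
def lyndonSubst (a b : A) (n : ℕ) (c : List Bool) : List A :=
  c.flatMap fun e => if e then lyndonSeq a b (n + 1) else lyndonSeq a b n

theorem lyndonSubst_append (a b : A) (n : ℕ) (c d : List Bool) :
    lyndonSubst a b n (c ++ d) = lyndonSubst a b n c ++ lyndonSubst a b n d :=
  List.flatMap_append

theorem lyndonSubst_cons (a b : A) (n : ℕ) (e : Bool) (c : List Bool) :
    lyndonSubst a b n (e :: c) =
      (if e then lyndonSeq a b (n + 1) else lyndonSeq a b n) ++ lyndonSubst a b n c := rfl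

/-- The order of the two blocks decides which of the two conjugate morphisms relates consecutive
levels. -/
theorem lyndonSubst_succ_of_lt {a b : A} {n : ℕ} (h : lyndonSeq a b n < lyndonSeq a b (n + 1))
    (c : List Bool) : lyndonSubst a b (n + 1) c = lyndonSubst a b n (fibMorphConj c) := by
  induction c with
  | nil => rfl
  | cons e c ih =>
    rw [lyndonSubst_cons, ih, fibMorphConj_cons, lyndonSubst_append]
    cases e <;> simp [lyndonSubst, lyndonSeq_add_two_of_lt h]

theorem lyndonSubst_succ_of_gt {a b : A} {n : ℕ} (h : lyndonSeq a b (n + 1) < lyndonSeq a b n)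
    (c : List Bool) : lyndonSubst a b (n + 1) c = lyndonSubst a b n (fibMorph c) := by
  induction c with
  | nil => rfl
  | cons e c ih =>
    rw [lyndonSubst_cons, ih, fibMorph_cons, lyndonSubst_append]
    cases e <;> simp [lyndonSubst, lyndonSeq_add_two_of_gt h]

theorem lyndonSubst_zero_fibWord (a b : A) (n : ℕ) :
    lyndonSubst a b 0 (fibWord true false n) = fibWord a b n := by
  induction n using Nat.twoStepInduction with
  | zero => rfl
  | one => rfl
  | more n h0 h1 => rw [fibWord, lyndonSubst_append, h0, h1, ← fibWord]

theorem exists_eq_lyndonSubst_zero {a b : A} {w : List A} {d : List Bool}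
    (h : w <:+: lyndonSubst a b 0 d) : ∃ c, c <:+: d ∧ w = lyndonSubst a b 0 c := by
  have e : ∀ c, lyndonSubst a b 0 c = c.map fun e => if e then a else b := by
    intro c
    induction c with
    | nil => rfl
    | cons e c ih => rw [lyndonSubst_cons, ih]; cases e <;> simp [lyndonSeq]
  obtain ⟨p, q, h⟩ := h
  rw [e] at h
  obtain ⟨l1, q', rfl, h1, -⟩ := List.append_eq_map_iff.1 h
  obtain ⟨p', c, rfl, -, h2⟩ := List.append_eq_map_iff.1 h1.symm
  exact ⟨c, ⟨p', q', rfl⟩, by rw [e, h2]⟩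

/-- A Lyndon word made of at least two blocks starts with the smaller block and ends with the
larger one. -/
theorem IsLyndon.lyndonSubst_ends {a b : A} {n : ℕ} {e e' : Bool} {c : List Bool}
    (h : IsLyndon (lyndonSubst a b n (e :: (c ++ [e'])))) (hab : a ≠ b) :
    (lyndonSeq a b n < lyndonSeq a b (n + 1) ∧ e = false ∧ e' = true) ∨
      (lyndonSeq a b (n + 1) < lyndonSeq a b n ∧ e = true ∧ e' = false) := by
  have hlast : (lyndonSubst a b n [e']) ≠ [] := by
    cases e' <;> simp [lyndonSubst, (isLyndon_lyndonSeq hab _).1]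
  have hfirst : (lyndonSubst a b n [e]) ≠ [] := by
    cases e <;> simp [lyndonSubst, (isLyndon_lyndonSeq hab _).1]
  have heq : lyndonSubst a b n (e :: (c ++ [e'])) =
      (lyndonSubst a b n [e] ++ lyndonSubst a b n c) ++ lyndonSubst a b n [e'] := by
    rw [← lyndonSubst_append, ← lyndonSubst_append]
    rfl
  rw [heq] at h
  have h1 := h.lt_suffix (by simp [hfirst]) hlast
  rw [List.append_assoc] at h1
  -- The first block is a prefix of the word, hence at most the word, which is smaller than its last
  -- block.
  have h2 := (le_append _ _).trans_lt h1
  cases e <;> cases e' <;> simp [lyndonSubst] at h2 ⊢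
  · exact h2
  · exact h2

theorem lyndon_eq_or_eq_lyndonSubst {a b : A} (hab : a ≠ b) {w : List A} (hw : IsLyndon w)
    {d : List Bool} (hd : FibLang d) (hwd : w = lyndonSubst a b 0 d) (n : ℕ) :
    (∃ i, w = lyndonSeq a b i) ∨ ∃ c, FibLang c ∧ w = lyndonSubst a b n c := by
  induction n with
  | zero => exact Or.inr ⟨d, hd, hwd⟩
  | succ n ih =>
    rcases ih with ih | ⟨c, hc, rfl⟩
    · exact Or.inl ih
    rcases c with _ | ⟨e, c⟩
    · exact absurd rfl hw.1
    rcases List.eq_nil_or_concat' c with rfl | ⟨c, e', rfl⟩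
    · left
      cases e
      · exact ⟨n, by simp [lyndonSubst]⟩
      · exact ⟨n + 1, by simp [lyndonSubst]⟩
    · right
      rcases hw.lyndonSubst_ends hab with ⟨hlt, rfl, rfl⟩ | ⟨hlt, rfl, rfl⟩
      · obtain ⟨c', hc', he⟩ := hc.exists_eq_fibMorphConj
        exact ⟨c', hc', by rw [lyndonSubst_succ_of_lt hlt, he]⟩
      · obtain ⟨c', hc', he⟩ := hc.exists_eq_fibMorph
        exact ⟨c', hc', by rw [lyndonSubst_succ_of_gt hlt, he]⟩

theorem le_length_lyndonSubst (a b : A) (n : ℕ) {c : List Bool} (hc : c ≠ []) :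
    Nat.fib (n + 1) ≤ (lyndonSubst a b n c).length := by
  obtain ⟨e, c, rfl⟩ := List.exists_cons_of_ne_nil hc
  rw [lyndonSubst_cons, List.length_append]
  have : Nat.fib (n + 1) ≤ Nat.fib (n + 1 + 1) := Nat.fib_mono (by omega)
  cases e
  · simp [length_lyndonSeq]
  · simp [length_lyndonSeq]
    omega

theorem lt_fib_add_five (n : ℕ) : n < Nat.fib (n + 5) :=
  lt_of_lt_of_le (by omega) (Nat.le_fib_self (n := n + 5) (by omega))

end LyndonSequence

/-! ### Fibonacci infinite words and their Lyndon count -/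

section FibonacciWord

/-- `g` is the Fibonacci infinite word built from `f₁ = b` and `f₂ = a`. -/
def IsFibonacciWordOf (a b : A) (g : ℕ → A) : Prop :=
  ∀ n, 1 ≤ n → IsPrefixOf (fibWord a b n) g

theorem IsFibonacciWordOf.mem_factors_iff {a b : A} {g : ℕ → A} (hg : IsFibonacciWordOf a b g)
    {w : List A} : w ∈ factors g ↔ ∃ n, w <:+: fibWord a b n := by
  constructor
  · rintro ⟨i, hi⟩
    have hl := (le_length_fibWord a b (i + w.length + 1)).1
    exact ⟨_, OccursAt.isInfix (hg (i + w.length + 1) (by omega)) hi (by omega) (by omega)⟩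
  · rintro ⟨n, hn⟩
    exact mem_factors_of_isInfix (hn.trans (fibWord_infix_add_two a b n)) ⟨0, hg _ (by omega)⟩

theorem IsFibonacciWordOf.recurrent {a b : A} {g : ℕ → A} (hg : IsFibonacciWordOf a b g) :
    Recurrent g := by
  intro w hw
  obtain ⟨n, hn⟩ := hg.mem_factors_iff.1 hw
  obtain ⟨p, q, hpq⟩ := hn.trans (fibWord_infix_add_two a b n)
  have h1 : OccursAt g (fibWord a b (n + 2)) 0 := hg _ (by omega)
  have h2 : OccursAt g (fibWord a b (n + 4)) 0 := hg _ (by omega)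
  have h3 := (occursAt_append.1 h2).2
  rw [← hpq, occursAt_append, occursAt_append] at h1 h3
  refine ⟨_, _, ?_, h1.1.2, h3.1.2⟩
  have := (le_length_fibWord a b (n + 2 + 1)).2
  omega

variable [LinearOrder A]

theorem IsFibonacciWordOf.lyndonSubst_mem {a b : A} {g : ℕ → A} (hg : IsFibonacciWordOf a b g)
    (hab : a ≠ b) (n : ℕ) {c : List Bool} (hc : FibLang c) :
    lyndonSubst a b n c ∈ factors g := by
  induction n generalizing c with
  | zero =>
    obtain ⟨n, p, q, h⟩ := hc
    refine hg.mem_factors_iff.2 ⟨n, lyndonSubst a b 0 p, lyndonSubst a b 0 q, ?_⟩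
    rw [← lyndonSubst_zero_fibWord, ← h, lyndonSubst_append, lyndonSubst_append]
  | succ n ih =>
    rcases lyndonSeq_lt_or_gt hab n with h | h
    · rw [lyndonSubst_succ_of_lt h]
      exact ih hc.fibMorphConj
    · rw [lyndonSubst_succ_of_gt h]
      exact ih hc.fibMorph

theorem IsFibonacciWordOf.lyndon_mem_factors_iff {a b : A} {g : ℕ → A}
    (hg : IsFibonacciWordOf a b g) (hab : a ≠ b) {w : List A} :
    (w ∈ factors g ∧ IsLyndon w) ↔ ∃ n, w = lyndonSeq a b n := by
  constructor
  · rintro ⟨hw, hwl⟩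
    obtain ⟨m, hm⟩ := hg.mem_factors_iff.1 hw
    rw [← lyndonSubst_zero_fibWord] at hm
    obtain ⟨d, hd, hwd⟩ := exists_eq_lyndonSubst_zero hm
    -- At this level each block has length at least `fib (w.length + 5)`, more than `w` has.
    rcases lyndon_eq_or_eq_lyndonSubst hab hwl ⟨m, hd⟩ hwd (w.length + 4) with h | ⟨c, -, h⟩
    · exact h
    · rcases eq_or_ne c [] with rfl | hc
      · exact absurd h hwl.1
      · have h1 := le_length_lyndonSubst a b (w.length + 4) hc
        rw [← h] at h1
        exact absurd (lt_fib_add_five w.length) (not_lt.2 h1)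
  · rintro ⟨n, rfl⟩
    refine ⟨?_, isLyndon_lyndonSeq hab n⟩
    have := hg.lyndonSubst_mem hab n (c := [false]) ⟨0, List.infix_rfl⟩
    simpa [lyndonSubst] using this

theorem IsFibonacciWordOf.lyndonCount_eq {a b : A} {g : ℕ → A} (hg : IsFibonacciWordOf a b g)
    (hab : a ≠ b) (n : ℕ) : lyndonCount g n = {k | Nat.fib (k + 1) ≤ n}.ncard := by
  rw [← Set.ncard_image_of_injective _ (lyndonSeq_injective hab), lyndonCount]
  congr 1
  ext w
  simp only [Set.mem_ofPred_eq, Set.mem_image, ← and_assoc, hg.lyndon_mem_factors_iff hab]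
  constructor
  · rintro ⟨⟨k, rfl⟩, h⟩
    exact ⟨k, by rwa [length_lyndonSeq] at h, rfl⟩
  · rintro ⟨k, h, rfl⟩
    exact ⟨⟨k, rfl⟩, by rwa [length_lyndonSeq]⟩

end FibonacciWord

/-! ### Tilings of a tail by two blocks -/

section Tiling

/-- `I` is a set of cut points of `x` each of which is followed by one of the blocks `u` and `v`
leading to another cut point. -/
def IsTiling (x : ℕ → A) (u v : List A) (I : Set ℕ) : Prop :=
  ∀ i ∈ I, (OccursAt x u i ∧ i + u.length ∈ I) ∨ (OccursAt x v i ∧ i + v.length ∈ I)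

/-- Some tail of `x` is a product of blocks `u` and `v`. -/
def Tiled (x : ℕ → A) (u v : List A) : Prop := ∃ I : Set ℕ, I.Nonempty ∧ IsTiling x u v I

theorem Tiled.symm {x : ℕ → A} {u v : List A} (h : Tiled x u v) : Tiled x v u := by
  obtain ⟨I, hI, h⟩ := h
  exact ⟨I, hI, fun i hi => (h i hi).symm⟩

theorem IsTiling.symm {x : ℕ → A} {u v : List A} {I : Set ℕ} (h : IsTiling x u v I) :
    IsTiling x v u I := fun i hi => (h i hi).symm

/-- In an aperiodic word, a block followed by itself is eventually followed by the other one. -/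
theorem IsTiling.exists_append {x : ℕ → A} (hx : Aperiodic x) {u v : List A} (hu : u ≠ [])
    {I : Set ℕ} (hI : IsTiling x u v I) {i : ℕ} (hi : i ∈ I) :
    ∃ k, i + k * u.length ∈ I ∧ OccursAt x v (i + k * u.length) ∧
      i + k * u.length + v.length ∈ I ∧ ∀ j < k, OccursAt x u (i + j * u.length) := by
  by_contra hcon
  have key : ∀ k, i + k * u.length ∈ I ∧ ∀ j < k, OccursAt x u (i + j * u.length) := by
    intro k
    induction k with
    | zero => simpa using hi
    | succ k ih =>
      rcases hI _ ih.1 with ⟨h1, h2⟩ | ⟨h1, h2⟩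
      · refine ⟨by rwa [Nat.succ_mul, ← Nat.add_assoc], fun j hj => ?_⟩
        rcases Nat.lt_succ_iff_lt_or_eq.1 hj with h | rfl
        · exact ih.2 j h
        · exact h1
      · exact absurd ⟨k, ih.1, h1, h2, ih.2⟩ hcon
  exact hx (ultimatelyPeriodic_of_occursAt hu i fun k => (key (k + 1)).2 k (by omega))

/-- By aperiodicity each run of `u` is followed by `v`; without `uuv` the run has length at most
one, so from a cut point of the old tiling either `v` or `uv` leads to another. -/
theorem Tiled.append_of_left_isolated {x : ℕ → A} (hx : Aperiodic x) {u v : List A} (hu : u ≠ [])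
    (h : Tiled x u v) (huv : u ++ (u ++ v) ∉ factors x) : Tiled x v (u ++ v) := by
  obtain ⟨I, hne, hI⟩ := h
  refine ⟨I, hne, fun i hi => ?_⟩
  obtain ⟨k, -, h2, h3, h4⟩ := hI.exists_append hx hu hi
  rcases k with _ | _ | k
  · left
    simpa using And.intro h2 h3
  · right
    have := h4 0 (by omega)
    simp only [Nat.zero_mul, Nat.add_zero, Nat.zero_add, Nat.one_mul] at this h2 h3
    exact ⟨occursAt_append.2 ⟨this, h2⟩, by rwa [List.length_append, ← Nat.add_assoc]⟩
  · have a1 := h4 k (by omega)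
    have a2 := h4 (k + 1) (by omega)
    refine absurd ⟨i + k * u.length, occursAt_append.2 ⟨a1, occursAt_append.2 ⟨?_, ?_⟩⟩⟩ huv
    · convert a2 using 1
      ring
    · convert h2 using 1
      ring

theorem Tiled.append_of_right_isolated {x : ℕ → A} (hx : Aperiodic x) {u v : List A} (hv : v ≠ [])
    (h : Tiled x u v) (huv : u ++ v ++ v ∉ factors x) : Tiled x u (u ++ v) := by
  obtain ⟨I, ⟨i₀, hi₀⟩, hI⟩ := h
  -- Keep only the cut points that start a block `u`: the next block is again `u`, or it is `v` and
  -- must then be followed by `u`.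
  refine ⟨{i | i ∈ I ∧ OccursAt x u i ∧ i + u.length ∈ I}, ?_, ?_⟩
  · obtain ⟨k, h1, h2, h3, -⟩ := hI.symm.exists_append hx hv hi₀
    exact ⟨_, h1, h2, h3⟩
  · rintro i ⟨hi, h1, h2⟩
    by_cases hu : OccursAt x u (i + u.length) ∧ i + u.length + u.length ∈ I
    · exact Or.inl ⟨h1, h2, hu⟩
    · right
      obtain ⟨h3, h4⟩ := (hI _ h2).resolve_left hu
      have h5 : OccursAt x (u ++ v) i := occursAt_append.2 ⟨h1, h3⟩
      refine ⟨h5, ?_⟩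
      rw [List.length_append, ← Nat.add_assoc]
      refine ⟨h4, (hI _ h4).resolve_right fun h6 => huv ⟨i, occursAt_append.2 ⟨h5, ?_⟩⟩⟩
      rw [List.length_append, ← Nat.add_assoc]
      exact h6.1

/-- Every position of the tiled tail lies in some block. -/
theorem IsTiling.exists_block {x : ℕ → A} {u v : List A} {I : Set ℕ} (hI : IsTiling x u v I)
    (hu : u ≠ []) (hv : v ≠ []) {m : ℕ} (hm : m ∈ I) {p : ℕ} (hp : m ≤ p) :
    ∃ i w, (w = u ∨ w = v) ∧ OccursAt x w i ∧ i ≤ p ∧ p < i + w.length ∧ i + w.length ∈ I := by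
  have hu' := List.length_pos_of_ne_nil hu
  have hv' := List.length_pos_of_ne_nil hv
  have hblock : ∀ i ∈ I, ∃ w, (w = u ∨ w = v) ∧ OccursAt x w i ∧ 0 < w.length ∧
      i + w.length ∈ I := by
    intro i hi
    rcases hI i hi with h | h
    · exact ⟨u, Or.inl rfl, h.1, hu', h.2⟩
    · exact ⟨v, Or.inr rfl, h.1, hv', h.2⟩
  induction p, hp using Nat.le_induction with
  | base =>
    obtain ⟨w, h1, h2, h3, h4⟩ := hblock m hm
    exact ⟨m, w, h1, h2, le_rfl, by omega, h4⟩
  | succ p hp ih =>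
    obtain ⟨i, w, h1, h2, h3, h4, h5⟩ := ih
    rcases Nat.lt_or_ge (p + 1) (i + w.length) with h | h
    · exact ⟨i, w, h1, h2, by omega, h, h5⟩
    · obtain ⟨w', h1', h2', h3', h4'⟩ := hblock _ h5
      exact ⟨_, w', h1', h2', h, by omega, h4'⟩

end Tiling

theorem IsFibonacciWordOf.letter_eq {a b : A} {g : ℕ → A} (hg : IsFibonacciWordOf a b g)
    (i : ℕ) : g i = a ∨ g i = b := by
  have hmem : ∀ n, ∀ c ∈ fibWord a b n, c = a ∨ c = b := by
    intro n
    induction n using Nat.twoStepInduction with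
    | zero => simp [fibWord]
    | one => simp [fibWord]
    | more n h0 h1 =>
      intro c hc
      rw [fibWord, List.mem_append] at hc
      exact hc.elim (h1 c) (h0 c)
  have hl := (le_length_fibWord a b (i + 1)).1
  have := hg (i + 1) (by omega) i (by omega)
  rw [Nat.zero_add] at this
  rw [← this]
  exact hmem _ _ (List.getElem_mem _)

/-! ### Tilings by consecutive Lyndon words -/

section LyndonTiling

variable [LinearOrder A]

/-- The Lyndon word that occurs in a tiling by two consecutive terms of `lyndonSeq` when the first
of these is not isolated. -/
def squareWord (a b : A) (n : ℕ) : List A :=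
  if lyndonSeq a b n < lyndonSeq a b (n + 1) then
    lyndonSeq a b n ++ (lyndonSeq a b n ++ lyndonSeq a b (n + 1))
  else lyndonSeq a b (n + 1) ++ lyndonSeq a b n ++ lyndonSeq a b n

theorem isLyndon_squareWord {a b : A} (hab : a ≠ b) (n : ℕ) : IsLyndon (squareWord a b n) := by
  have h0 := isLyndon_lyndonSeq hab n
  have h1 := isLyndon_lyndonSeq hab (n + 1)
  rw [squareWord]
  split_ifs with h
  · exact h0.append_append_left h1 h
  · exact h1.append_append_right h0 ((lyndonSeq_lt_or_gt hab n).resolve_left h)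

theorem length_squareWord (a b : A) (n : ℕ) :
    (squareWord a b n).length = Nat.fib (n + 1) + Nat.fib (n + 3) := by
  have : Nat.fib (n + 3) = Nat.fib (n + 1) + Nat.fib (n + 1 + 1) := Nat.fib_add_two
  rw [squareWord]
  split_ifs <;> simp only [List.length_append, length_lyndonSeq] <;> omega

theorem fib_lt_length_squareWord (a b : A) {n : ℕ} (hn : 1 ≤ n) :
    Nat.fib (n + 3) < (squareWord a b n).length ∧
      (squareWord a b n).length < Nat.fib (n + 4) := by
  have h1 : Nat.fib (n + 4) = Nat.fib (n + 2) + Nat.fib (n + 3) := Nat.fib_add_two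
  have h2 : Nat.fib (n + 1) < Nat.fib (n + 2) := Nat.fib_lt_fib_succ (by omega)
  have h3 : 0 < Nat.fib (n + 1) := Nat.fib_pos.2 (by omega)
  rw [length_squareWord]
  omega

theorem fib_ne_length_squareWord (a b : A) {n : ℕ} (hn : 1 ≤ n) (k : ℕ) :
    Nat.fib k ≠ (squareWord a b n).length := by
  obtain ⟨h1, h2⟩ := fib_lt_length_squareWord a b hn
  rcases Nat.lt_or_ge k (n + 4) with h | h
  · have : Nat.fib k ≤ Nat.fib (n + 3) := Nat.fib_mono (by omega)
    omega
  · have : Nat.fib (n + 4) ≤ Nat.fib k := Nat.fib_mono h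
    omega

theorem tiled_lyndonSeq {a b : A} (hab : a ≠ b) {x : ℕ → A} (hx : Aperiodic x)
    (hxab : ∀ i, x i = a ∨ x i = b) (hsq : ∀ n, squareWord a b n ∉ factors x) (n : ℕ) :
    Tiled x (lyndonSeq a b n) (lyndonSeq a b (n + 1)) := by
  induction n with
  | zero =>
    refine ⟨Set.univ, ⟨0, trivial⟩, fun i _ => ?_⟩
    have hs : ∀ c, x i = c → OccursAt x [c] i := by
      intro c hc j hj
      simp at hj
      simp [hj, hc]
    rcases hxab i with h | h
    · exact Or.inr ⟨hs a h, trivial⟩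
    · exact Or.inl ⟨hs b h, trivial⟩
  | succ n ih =>
    have hn := (isLyndon_lyndonSeq hab n).1
    have := hsq n
    rw [squareWord] at this
    split_ifs at this with h
    · rw [lyndonSeq_add_two_of_lt h]
      exact ih.append_of_left_isolated hx hn this
    · rw [lyndonSeq_add_two_of_gt ((lyndonSeq_lt_or_gt hab n).resolve_left h)]
      exact ih.symm.append_of_right_isolated hx hn this

theorem IsFibonacciWordOf.factors_subset {a b : A} {g : ℕ → A} (hg : IsFibonacciWordOf a b g)
    (hab : a ≠ b) {x : ℕ → A} (hx : Recurrent x)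
    (ht : ∀ n, Tiled x (lyndonSeq a b n) (lyndonSeq a b (n + 1))) : factors x ⊆ factors g := by
  intro w hw
  -- Blocks at level `n + 1` have length at least `fib (w.length + 5)`, so `w` meets at most two
  -- consecutive ones.
  set n := w.length + 3 with hn
  have hpair : ∀ e e', lyndonSubst a b (n + 1) [e, e'] ∈ factors g := by
    intro e e'
    rcases lyndonSeq_lt_or_gt hab n with h | h
    · rw [lyndonSubst_succ_of_lt h]
      exact hg.lyndonSubst_mem hab n (fibLang_fibMorphConj_pair e e')
    · rw [lyndonSubst_succ_of_gt h]
      exact hg.lyndonSubst_mem hab n (fibLang_fibMorph_pair e e')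
  obtain ⟨I, ⟨m, hm⟩, hI⟩ := ht (n + 1)
  have h0 := (isLyndon_lyndonSeq hab (n + 1)).1
  have h1 := (isLyndon_lyndonSeq hab (n + 1 + 1)).1
  obtain ⟨p, hmp, hp⟩ := hx.exists_occursAt_ge hw m
  obtain ⟨i, t, ht, hit, hip, hpi, hiI⟩ := hI.exists_block h0 h1 hm hmp
  have hblock : ∀ t, t = lyndonSeq a b (n + 1) ∨ t = lyndonSeq a b (n + 1 + 1) →
      ∃ e, t = lyndonSubst a b (n + 1) [e] := by
    rintro t (rfl | rfl)
    · exact ⟨false, by simp [lyndonSubst]⟩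
    · exact ⟨true, by simp [lyndonSubst]⟩
  obtain ⟨t', ht', hit'⟩ : ∃ t', (t' = lyndonSeq a b (n + 1) ∨ t' = lyndonSeq a b (n + 1 + 1)) ∧
      OccursAt x t' (i + t.length) := by
    rcases hI _ hiI with h | h
    · exact ⟨_, Or.inl rfl, h.1⟩
    · exact ⟨_, Or.inr rfl, h.1⟩
  obtain ⟨e, he⟩ := hblock t ht
  obtain ⟨e', he'⟩ := hblock t' ht'
  have hlen : w.length < t'.length := by
    have := le_length_lyndonSubst a b (n + 1) (c := [e']) (by simp)
    rw [← he'] at this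
    exact (lt_fib_add_five w.length).trans_le this
  have hmem := hpair e e'
  rw [show [e, e'] = [e] ++ [e'] from rfl, lyndonSubst_append, ← he, ← he'] at hmem
  exact mem_factors_of_isInfix ((occursAt_append.2 ⟨hit, hit'⟩).isInfix hp hip
    (by rw [List.length_append]; omega)) hmem

theorem IsFibonacciWordOf.aperiodic {a b : A} {g : ℕ → A} (hg : IsFibonacciWordOf a b g)
    (hab : a ≠ b) : Aperiodic g := by
  intro hp
  obtain ⟨p, hp⟩ := hg.recurrent.exists_length_le_of_ultimatelyPeriodic hp
  obtain ⟨h1, h2⟩ := (hg.lyndon_mem_factors_iff hab).2 ⟨p + 4, rfl⟩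
  have h3 := hp _ h1 h2
  rw [length_lyndonSeq] at h3
  exact absurd (lt_fib_add_five p) (not_lt.2 h3)

theorem count_lyndonSeq_add_two (a b : A) (n : ℕ) (c : A) :
    (lyndonSeq a b (n + 2)).count c =
      (lyndonSeq a b n).count c + (lyndonSeq a b (n + 1)).count c := by
  rw [lyndonSeq]
  split_ifs
  · rw [List.count_append]
  · rw [List.count_append, Nat.add_comm]

theorem count_squareWord (a b : A) (n : ℕ) (c : A) :
    (squareWord a b n).count c =
      2 * (lyndonSeq a b n).count c + (lyndonSeq a b (n + 1)).count c := by
  rw [squareWord]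
  split_ifs <;> simp only [List.count_append] <;> omega

/-- Lengths separate the words for `n ≥ 1`. For `n = 0` the length is `3 = fib 4`, and the number of
letters `b` separates them: two against one. -/
theorem squareWord_ne_lyndonSeq {a b : A} (hab : a ≠ b) (n k : ℕ) :
    squareWord a b n ≠ lyndonSeq a b k := by
  intro h
  have hl := congrArg List.length h
  rw [length_lyndonSeq] at hl
  rcases Nat.eq_zero_or_pos n with rfl | hn
  · have hk : k = 3 := by
      rw [length_squareWord] at hl
      by_contra hk
      rcases Nat.lt_or_ge k 3 with h | h
      · have : Nat.fib (k + 1) ≤ Nat.fib 3 := Nat.fib_mono (by omega)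
        simp [Nat.fib] at *
        omega
      · have : Nat.fib 5 ≤ Nat.fib (k + 1) := Nat.fib_mono (by omega)
        simp [Nat.fib] at *
        omega
    subst hk
    have hsq := count_squareWord a b 0 b
    rw [h, count_lyndonSeq_add_two a b 1 b, count_lyndonSeq_add_two a b 0 b] at hsq
    simp [lyndonSeq, hab] at hsq
  · exact fib_ne_length_squareWord a b hn _ hl.symm

theorem IsFibonacciWordOf.tiled {a b : A} {g : ℕ → A} (hg : IsFibonacciWordOf a b g)
    (hab : a ≠ b) (n : ℕ) : Tiled g (lyndonSeq a b n) (lyndonSeq a b (n + 1)) := by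
  refine tiled_lyndonSeq hab (hg.aperiodic hab) hg.letter_eq (fun m hm => ?_) n
  obtain ⟨k, hk⟩ := (hg.lyndon_mem_factors_iff hab).1 ⟨hm, isLyndon_squareWord hab m⟩
  exact squareWord_ne_lyndonSeq hab m k hk

theorem lyndonSeq_infix_add_two (a b : A) (n : ℕ) :
    lyndonSeq a b n <:+: lyndonSeq a b (n + 2) := by
  rw [lyndonSeq]
  split_ifs
  · exact (List.prefix_append _ _).isInfix
  · exact (List.suffix_append _ _).isInfix

theorem lyndonSeq_infix_succ (a b : A) (n : ℕ) :
    lyndonSeq a b (n + 1) <:+: lyndonSeq a b (n + 1 + 1) := by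
  rw [lyndonSeq]
  split_ifs
  · exact (List.suffix_append _ _).isInfix
  · exact (List.prefix_append _ _).isInfix

/-- Every word in the shift orbit closure of a Fibonacci word has the same Lyndon factors. -/
theorem IsFibonacciWordOf.lyndonSeq_mem {a b : A} {g : ℕ → A} (hg : IsFibonacciWordOf a b g)
    (hab : a ≠ b) {x : ℕ → A} (hx : factors x ⊆ factors g) (n : ℕ) :
    lyndonSeq a b n ∈ factors x := by
  -- Index `0` is treated apart because `[b]` is not contained in the next word `[a]`.
  suffices h : ∀ n, lyndonSeq a b (n + 1) ∈ factors x by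
    rcases n with _ | n
    · exact mem_factors_of_isInfix (lyndonSeq_infix_add_two a b 0) (h 1)
    · exact h n
  intro n
  obtain ⟨I, ⟨m, hm⟩, hI⟩ := hg.tiled hab (n + 1)
  have h0 := (isLyndon_lyndonSeq hab (n + 1)).1
  have h1 := (isLyndon_lyndonSeq hab (n + 1 + 1)).1
  have hmono : Nat.fib (n + 2) ≤ Nat.fib (n + 3) := Nat.fib_mono (by omega)
  have hlen : ∀ t, t = lyndonSeq a b (n + 1) ∨ t = lyndonSeq a b (n + 1 + 1) →
      t.length ≤ Nat.fib (n + 3) ∧ lyndonSeq a b (n + 1) <:+: t := by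
    rintro t (rfl | rfl)
    · rw [length_lyndonSeq]
      exact ⟨hmono, List.infix_rfl⟩
    · rw [length_lyndonSeq]
      exact ⟨le_rfl, lyndonSeq_infix_succ a b n⟩
  -- A window of twice the maximal block length contains the whole block following the one in which
  -- it starts.
  set w := List.ofFn fun j : Fin (Nat.fib (n + 3) + Nat.fib (n + 3)) => x (0 + j) with hw
  have hwl : w.length = Nat.fib (n + 3) + Nat.fib (n + 3) := by simp [hw]
  have hwx : w ∈ factors x := ⟨0, occursAt_ofFn x 0 _⟩
  obtain ⟨p, hmp, hp⟩ := hg.recurrent.exists_occursAt_ge (hx hwx) m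
  obtain ⟨i, t, ht, hit, hip, hpi, hiI⟩ := hI.exists_block h0 h1 hm hmp
  have hl := (hlen t ht).1
  obtain ⟨t', ht', hit'⟩ : ∃ t', (t' = lyndonSeq a b (n + 1) ∨ t' = lyndonSeq a b (n + 1 + 1)) ∧
      OccursAt g t' (i + t.length) := by
    rcases hI _ hiI with h | h
    · exact ⟨_, Or.inl rfl, h.1⟩
    · exact ⟨_, Or.inr rfl, h.1⟩
  have hl' := (hlen t' ht').1
  exact mem_factors_of_isInfix ((hlen t' ht').2.trans (hp.isInfix hit' (by omega) (by omega))) hwx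

theorem IsFibonacciWordOf.lyndonCount_eq_of_factors_subset {a b : A} {g : ℕ → A}
    (hg : IsFibonacciWordOf a b g) (hab : a ≠ b) {x : ℕ → A} (hx : factors x ⊆ factors g)
    (n : ℕ) : lyndonCount x n = lyndonCount g n := by
  rw [lyndonCount, lyndonCount]
  congr 1
  ext w
  refine ⟨fun h => ⟨hx h.1, h.2⟩, fun h => ⟨?_, h.2⟩⟩
  obtain ⟨k, rfl⟩ := (hg.lyndon_mem_factors_iff hab).1 ⟨h.1, h.2.1⟩
  exact hg.lyndonSeq_mem hab hx k

end LyndonTiling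

/-! ### Comparison of the counts -/

section Main

variable [LinearOrder A] [Finite A]

theorem finite_fib_le (n : ℕ) : {k | Nat.fib (k + 1) ≤ n}.Finite :=
  (Set.finite_lt_nat (n + 4)).subset fun k hk => by
    by_contra h
    have h1 : Nat.fib (n + 5) ≤ Nat.fib (k + 1) := Nat.fib_mono (by simp at h; omega)
    have h2 := lt_fib_add_five n
    simp at hk
    omega

theorem Aperiodic.ncard_fib_le_lyndonCount {x : ℕ → A} (hx : Aperiodic x) (n : ℕ) :
    {k | Nat.fib (k + 1) ≤ n}.ncard ≤ lyndonCount x n := by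
  rcases Set.eq_empty_or_nonempty {k | Nat.fib (k + 1) ≤ n} with h | h
  · simp [h]
  obtain ⟨k, hk, hmax⟩ := Set.exists_max_image _ id (finite_fib_le n) h
  calc {k | Nat.fib (k + 1) ≤ n}.ncard ≤ (Set.Iio (k + 1)).ncard :=
        Set.ncard_le_ncard (fun j hj => Nat.lt_succ_of_le (hmax j hj)) (Set.finite_Iio _)
    _ = k + 1 := by simp [Set.ncard_eq_toFinset_card']
    _ ≤ lyndonCount x (Nat.fib (k + 1)) := (hx.le_lyndonCount_fib k).1
    _ ≤ lyndonCount x n := lyndonCount_mono x hk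

theorem ncard_fib_le_one : {k | Nat.fib (k + 1) ≤ 1}.ncard = 2 := by
  have : {k | Nat.fib (k + 1) ≤ 1} = {0, 1} := by
    ext k
    simp only [Set.mem_ofPred_eq, Set.mem_insert_iff, Set.mem_singleton_iff]
    constructor
    · intro h
      by_contra hk
      have : Nat.fib 3 ≤ Nat.fib (k + 1) := Nat.fib_mono (by omega)
      simp [Nat.fib] at *
      omega
    · rintro (rfl | rfl) <;> simp
  rw [this, Set.ncard_pair (by omega)]

theorem ncard_fib_le_three_le : {k | Nat.fib (k + 1) ≤ 3}.ncard ≤ 4 := by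
  have : {k | Nat.fib (k + 1) ≤ 3} ⊆ Set.Iio 4 := by
    intro k h
    by_contra hk
    have : Nat.fib 5 ≤ Nat.fib (k + 1) := Nat.fib_mono (by simp at hk; omega)
    simp [Nat.fib] at *
    omega
  exact (Set.ncard_le_ncard this (Set.finite_Iio _)).trans (by
    simp [Set.ncard_eq_toFinset_card'])

theorem lyndonCount_lt_of_mem {x : ℕ → A} {w : List A} (hw : w ∈ factors x) (hl : IsLyndon w)
    {m : ℕ} (hm : m < w.length) : lyndonCount x m < lyndonCount x w.length :=
  Set.ncard_lt_ncard ⟨fun _ h => ⟨h.1, h.2.1, h.2.2.trans hm.le⟩, fun h =>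
    absurd (h ⟨hw, hl, le_rfl⟩).2.2 (not_le.2 hm)⟩ (finite_lyndon_length_le x _)

/-- A Lyndon factor makes the count jump at its length, while the Fibonacci count jumps only at
Fibonacci numbers. -/
theorem squareWord_not_mem {x : ℕ → A} (h : ∀ n, lyndonCount x n = {k | Nat.fib (k + 1) ≤ n}.ncard)
    {a b : A} (hab : a ≠ b) {n : ℕ} (hn : 1 ≤ n) : squareWord a b n ∉ factors x := by
  intro hmem
  obtain ⟨h1, h2⟩ := fib_lt_length_squareWord a b hn
  have hlt := lyndonCount_lt_of_mem hmem (isLyndon_squareWord hab n)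
    (m := (squareWord a b n).length - 1) (by omega)
  rw [h, h] at hlt
  refine hlt.ne ?_
  congr 1
  ext k
  have := fib_ne_length_squareWord a b hn (k + 1)
  simp only [Set.mem_ofPred_eq]
  omega

/-- Of the words `ppq` and `pqq` only one occurs in a word with few Lyndon factors. -/
theorem not_mem_or_not_mem {x : ℕ → A} (h : lyndonCount x 3 ≤ 4) {p q : A} (hpq : p < q) :
    [p, p, q] ∉ factors x ∨ [p, q, q] ∉ factors x := by
  by_contra! hcon
  obtain ⟨h1, h2⟩ := hcon
  have hp := isLyndon_singleton p
  have hq := isLyndon_singleton q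
  have hlt : [p] < [q] := List.Lex.rel hpq
  have hne := hpq.ne
  have hsub : (({[p], [q], [p, q], [p, p, q], [p, q, q]} : Finset (List A)) : Set (List A)) ⊆
      {w | w ∈ factors x ∧ IsLyndon w ∧ w.length ≤ 3} := by
    intro w hw
    simp only [Finset.coe_insert, Finset.coe_singleton, Set.mem_insert_iff,
      Set.mem_singleton_iff] at hw
    rcases hw with rfl | rfl | rfl | rfl | rfl
    · exact ⟨mem_factors_of_isInfix ⟨[], [p, q], rfl⟩ h1, hp, by simp⟩
    · exact ⟨mem_factors_of_isInfix ⟨[p, p], [], rfl⟩ h1, hq, by simp⟩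
    · exact ⟨mem_factors_of_isInfix ⟨[p], [], rfl⟩ h1, hp.append hq hlt, by simp⟩
    · exact ⟨h1, hp.append_append_left hq hlt, by simp⟩
    · exact ⟨h2, hp.append_append_right hq hlt, by simp⟩
  have hle := Set.ncard_le_ncard hsub (finite_lyndon_length_le x 3)
  rw [Set.ncard_coe_finset] at hle
  have hcard : ({[p], [q], [p, q], [p, p, q], [p, q, q]} : Finset (List A)).card = 5 := by
    simp [Finset.card_insert_of_notMem, hne, hne.symm]
  have : lyndonCount x 3 = {w | w ∈ factors x ∧ IsLyndon w ∧ w.length ≤ 3}.ncard := rfl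
  omega

theorem exists_letters {x : ℕ → A} (h : ∀ n, lyndonCount x n = {k | Nat.fib (k + 1) ≤ n}.ncard) :
    ∃ a b, a ≠ b ∧ (∀ i, x i = a ∨ x i = b) ∧ squareWord a b 0 ∉ factors x := by
  have h1 := h 1
  rw [ncard_fib_le_one, lyndonCount, Set.ncard_eq_two] at h1
  obtain ⟨u, v, huv, hS⟩ := h1
  have hsingle : ∀ w : List A, w ∈ factors x ∧ IsLyndon w ∧ w.length ≤ 1 → ∃ c, w = [c] := by
    rintro w ⟨-, hw, hl⟩
    have := List.length_pos_of_ne_nil hw.1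
    exact List.length_eq_one_iff.1 (by omega)
  obtain ⟨p, rfl⟩ := hsingle u (hS.ge (Set.mem_insert u {v}))
  obtain ⟨q, rfl⟩ := hsingle v (hS.ge (Set.mem_insert_of_mem [p] rfl))
  have hpq : p ≠ q := fun h => huv (by rw [h])
  have hx : ∀ i, x i = p ∨ x i = q := by
    intro i
    have : [x i] ∈ {w | w ∈ factors x ∧ IsLyndon w ∧ w.length ≤ 1} :=
      ⟨⟨i, fun j hj => by simp at hj; simp [hj]⟩, isLyndon_singleton _, by simp⟩
    rw [hS] at this
    simpa using this
  clear hS hsingle huv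
  wlog hlt : p < q generalizing p q
  · exact this q p hpq.symm (fun i => (hx i).symm) (lt_of_le_of_ne (not_lt.1 hlt) hpq.symm)
  have hlt' : [p] < [q] := List.Lex.rel hlt
  -- The letter to be called `b` is the one not doubled in `x`: `squareWord` at `0` is `bba` if `b <
  -- a` and `abb` if `a < b`.
  rcases not_mem_or_not_mem ((h 3).trans_le ncard_fib_le_three_le) hlt with h3 | h3
  · refine ⟨q, p, hpq.symm, fun i => (hx i).symm, ?_⟩
    simpa [squareWord, lyndonSeq, hlt'] using h3
  · refine ⟨p, q, hpq, hx, ?_⟩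
    simpa [squareWord, lyndonSeq, hlt'.not_gt] using h3

theorem exists_fibonacciWord_of_lyndonCount_eq {x : ℕ → A} (hx : Recurrent x) (hxa : Aperiodic x)
    (h : ∀ n, lyndonCount x n = {k | Nat.fib (k + 1) ≤ n}.ncard) :
    ∃ g : ℕ → A, IsFibonacciWord g ∧ x ∈ shiftOrbitClosure g := by
  obtain ⟨a, b, hab, hxab, hsq⟩ := exists_letters h
  obtain ⟨g, hg, -⟩ := existsUnique_fibonacciWord a b
  refine ⟨g, ⟨a, b, hab, hg⟩, IsFibonacciWordOf.factors_subset hg hab hx ?_⟩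
  refine tiled_lyndonSeq hab hxa hxab fun n => ?_
  rcases Nat.eq_zero_or_pos n with rfl | hn
  · exact hsq
  · exact squareWord_not_mem h hab hn

theorem Recurrent.aperiodic_of_lyndonCount_le {x : ℕ → A} (hx : Recurrent x)
    (h : ∀ n, {k | Nat.fib (k + 1) ≤ n}.ncard ≤ lyndonCount x n) : Aperiodic x := by
  intro hp
  obtain ⟨p, hp⟩ := hx.exists_length_le_of_ultimatelyPeriodic hp
  have hbound : ∀ n, lyndonCount x n ≤ lyndonCount x p := fun n =>
    Set.ncard_le_ncard (fun w hw => ⟨hw.1, hw.2.1, hp w hw.1 hw.2.1⟩)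
      (finite_lyndon_length_le x p)
  set N := lyndonCount x p
  -- The indices `0, …, N` already contribute `N + 1` at this length, more than the bound `N`.
  have h1 := (h (Nat.fib (N + 1))).trans (hbound _)
  have h2 : (Set.Iio (N + 1)).ncard ≤ {k | Nat.fib (k + 1) ≤ Nat.fib (N + 1)}.ncard :=
    Set.ncard_le_ncard (fun k hk => Nat.fib_mono (by simp at hk; omega)) (finite_fib_le _)
  have h3 : (Set.Iio (N + 1)).ncard = N + 1 := by simp [Set.ncard_eq_toFinset_card']
  omega

end Main

end LyndonFib

theorem theorem060720122147 {A : Type*} [LinearOrder A] [Finite A] [Nontrivial A]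
    (x : ℕ → A) (hx : LyndonFib.Recurrent x)
    (f : ℕ → A) (hf : LyndonFib.IsFibonacciWord f) :
    (LyndonFib.Aperiodic x ↔
      ∀ n, LyndonFib.lyndonCount f n ≤ LyndonFib.lyndonCount x n) ∧
    ((∀ n, LyndonFib.lyndonCount x n = LyndonFib.lyndonCount f n) ↔
      ∃ g : ℕ → A, LyndonFib.IsFibonacciWord g ∧ x ∈ LyndonFib.shiftOrbitClosure g) := by
  obtain ⟨a, b, hab, hf⟩ := hf
  simp only [LyndonFib.IsFibonacciWordOf.lyndonCount_eq hf hab]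
  refine ⟨⟨fun h => h.ncard_fib_le_lyndonCount, hx.aperiodic_of_lyndonCount_le⟩, fun h => ?_, ?_⟩
  · exact LyndonFib.exists_fibonacciWord_of_lyndonCount_eq hx
      (hx.aperiodic_of_lyndonCount_le fun n => (h n).ge) h
  · rintro ⟨g, ⟨c, d, hcd, hg⟩, hxg⟩ n
    rw [LyndonFib.IsFibonacciWordOf.lyndonCount_eq_of_factors_subset hg hcd hxg,
      LyndonFib.IsFibonacciWordOf.lyndonCount_eq hg hcd]
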